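/- **Setting.** A dataset is a finite sequence of records from a set $\mathcal X$; let $\mathcal D$ be a set of datasets. Let $d:\mathcal D\times\mathcal D\to\mathbb Z_{\ge 0}$ be an adjacency metric: a metric such that $d(X,X')=a$ if and only if $a$ is the least length of a chain $X=X_0,X_1,\dots,X_a=X'$ in $\mathcal D$ with $d(X_{j-1},X_j)=1$ for all $j$. Put $A_m(X,X')=\mathbf 1\{d(X,X')\le m\}$. Let $T$ be an invariant (a function on $\mathcal D$), $t$ a value, and $\mathcal D_t=\{X\in\mathcal D: T(X)=t\}$; assume that every dataset in $\mathcal D_t$ has the same number $n$ of records. Put $\mathcal D_t^i=\{x\in\mathcal X:\exists X\in\mathcal D_t,\ X_i=x\}$ and let $$a=a(t)=\sup_{i\in[n]}\ \sup_{x,y\in\mathcal D_t^i}\ \inf\{d(X,Y):X,Y\in\mathcal D_t,\ X_i=x,\ Y_i=y\}$$ be the semi-adjacent parameter, assumed finite. For probability measures $P,Q$ on a measurable space, let $T(P,Q):[0,1]\to[0,1]$, $T(P,Q)(\alpha)=\inf\{1-\mathbb E_Q\varphi:\mathbb E_P\varphi\le 1-\alpha\}$, the infimum being over all measurable $\varphi$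 with values in $[0,1]$. A tradeoff function is a function of the form $T(P,Q)$. The tensor product of tradeoff functions $f_i=T(P_i,Q_i)$, $i\in[k]$, is $f_1\otimes\cdots\otimes f_k=T(P_1\times\cdots\times P_k,\,Q_1\times\cdots\times Q_k)$, which does not depend on the choice of the $P_i,Q_i$; $f^{\circ a}$ is the $a$-fold composition of $f$ with itself. For $\mathcal D'\subseteq\mathcal D$ and an adjacency function $A$, a mechanism $M$ (assigning to each dataset $X$ the law $M(X)$ of a random output) is $(\mathcal D',A,f)$-DP if $T(M(X),M(X'))\ge f$ pointwise for all $X,X'\in\mathcal D'$ with $A(X,X')=1$. Write $(\mathcal D',A',g)\text{-DP}\preceq(\mathcal D'',A'',h)\text{-DP}$ (the latter guarantee is stronger) if $\{(X,X')\in\mathcal D'\times\mathcal D':A'(X,X')=1\}\subseteq\{(X,X')\in\mathcal D''\times\mathcal D'':A''(X,X')=1\}$ and $g\le h$ pointwise. **Proposition.** Let $f_1,\dots,f_k$ be tradeoff functions, and for each $i\in[k]$ let $M_i:\mathcal D\to\mathcal Y_i$ be a $(\mathcal D,A_1,f_i)$-DP mechanism. Let $M(X)=(M_1(X),\dots,M_k(X))$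 be the joint release, the mechanisms being run independently. Then each $f_i^{\circ a}$ is a tradeoff function, the tensor products below are well defined, and: 1. (Semi-DP first) each $M_i$ is $(\mathcal D_t,A_{a(t)},f_i^{\circ a})$-DP, and $M$ is $(\mathcal D_t,A_{a(t)},f_1^{\circ a}\otimes\cdots\otimes f_k^{\circ a})$-DP; 2. (Composition first) $M$ is $(\mathcal D,A_1,f_1\otimes\cdots\otimes f_k)$-DP, and it is $(\mathcal D_t,A_{a(t)},(f_1\otimes\cdots\otimes f_k)^{\circ a})$-DP; 3. $(\mathcal D_t,A_{a(t)},(f_1\otimes\cdots\otimes f_k)^{\circ a})\text{-DP}\preceq(\mathcal D_t,A_{a(t)},f_1^{\circ a}\otimes\cdots\otimes f_k^{\circ a})\text{-DP}$, so the Semi-DP first guarantee is the stronger one. -/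

import Mathlib

open scoped unitInterval

universe u

noncomputable section

namespace SemiDP

open MeasureTheory

/-! ### Hypothesis testing and tradeoff functions -/

/-- The set of achievable values `1 - E_Q φ` over all measurable tests `φ : Ω → [0,1]`
with `E_P φ ≤ 1 - α`. -/
def typeTwoErrors {Ω : Type*} [MeasurableSpace Ω] (P Q : ProbabilityMeasure Ω) (α : I) : Set ℝ :=
  {β | ∃ φ : Ω → I, Measurable φ ∧
    ∫ ω, (φ ω : ℝ) ∂(P : Measure Ω) ≤ 1 - (α : ℝ) ∧ β = 1 - ∫ ω, (φ ω : ℝ) ∂(Q : Measure Ω)}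

theorem typeTwoErrors_nonneg {Ω : Type*} [MeasurableSpace Ω] (P Q : ProbabilityMeasure Ω) (α : I) :
    ∀ β ∈ typeTwoErrors P Q α, 0 ≤ β := by
  rintro β ⟨φ, hφ, -, rfl⟩
  have h : ∫ ω, (φ ω : ℝ) ∂(Q : Measure Ω) ≤ ∫ _, (1 : ℝ) ∂(Q : Measure Ω) := by
    refine integral_mono_of_nonneg (Filter.Eventually.of_forall fun ω => (φ ω).2.1)
      (integrable_const _) (Filter.Eventually.of_forall fun ω => (φ ω).2.2)
  simp at h
  linarith

theorem one_mem_typeTwoErrors {Ω : Type*} [MeasurableSpace Ω] (P Q : ProbabilityMeasure Ω)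
    (α : I) : (1 : ℝ) ∈ typeTwoErrors P Q α :=
  ⟨fun _ => 0, measurable_const, by simpa using α.2.2, by simp⟩

/-- `T(P, Q)(α) = inf {1 - E_Q φ : E_P φ ≤ 1 - α}`, as a function `[0,1] → [0,1]`. -/
def tradeoff {Ω : Type*} [MeasurableSpace Ω] (P Q : ProbabilityMeasure Ω) (α : I) : I :=
  ⟨sInf (typeTwoErrors P Q α),
    le_csInf ⟨1, one_mem_typeTwoErrors P Q α⟩ (typeTwoErrors_nonneg P Q α),
    csInf_le ⟨0, typeTwoErrors_nonneg P Q α⟩ (one_mem_typeTwoErrors P Q α)⟩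

/-- A tradeoff function is a function of the form `T(P, Q)`. -/
def IsTradeoffFunction (f : I → I) : Prop :=
  ∃ (Ω : Type u) (_ : MeasurableSpace Ω) (P Q : ProbabilityMeasure Ω), f = tradeoff P Q

/-- `F = f₁ ⊗ ⋯ ⊗ f_k`: the `f_i` are tradeoff functions and, whenever `f_i = T(P_i, Q_i)` for
all `i`, `F = T(P₁ × ⋯ × P_k, Q₁ × ⋯ × Q_k)`. The first clause provides such `P_i, Q_i`, so that at
most one `F` qualifies; that some `F` does is the independence of the choice of `P_i, Q_i`. -/
def IsTensorProduct {k : ℕ} (f : Fin k → I → I) (F : I → I) : Prop :=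
  (∀ i, IsTradeoffFunction.{u} (f i)) ∧
  ∀ (Ω : Fin k → Type u) [∀ i, MeasurableSpace (Ω i)] (P Q : ∀ i, ProbabilityMeasure (Ω i)),
    (∀ i, f i = tradeoff (P i) (Q i)) →
      F = tradeoff (ProbabilityMeasure.pi P) (ProbabilityMeasure.pi Q)

/-! ### Adjacency, differential privacy guarantees and their comparison -/

/-- A metric `d` with values in the nonnegative integers such that `d X X' = a` if and only if `a` is
the least length of a chain from `X` to `X'` whose consecutive members are at distance `1`. -/
structure IsAdjacencyMetric {D : Type*} (d : D → D → ℕ) : Prop where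
  eq_zero_iff : ∀ X X', d X X' = 0 ↔ X = X'
  symm : ∀ X X', d X X' = d X' X
  triangle : ∀ X X' X'', d X X'' ≤ d X X' + d X' X''
  chain : ∀ X X' a, d X X' = a ↔
    IsLeast {m : ℕ | ∃ p : ℕ → D, p 0 = X ∧ p m = X' ∧ ∀ j < m, d (p j) (p (j + 1)) = 1} a

/-- `A_m(X, X') = 1`, that is, `d X X' ≤ m`. -/
def adj {D : Type*} (d : D → D → ℕ) (m : ℕ) (X X' : D) : Prop := d X X' ≤ m

/-- The data `(𝒟', A, f)` of a privacy guarantee, for a dataspace `𝒟'` inside an ambient `D`. -/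
structure Guarantee (D : Type*) where
  space : Set D
  adjacent : D → D → Prop
  param : I → I

/-- The indistinguishable pairs `IND(𝒟', A)`. -/
def Guarantee.ind {D : Type*} (G : Guarantee D) : Set (D × D) :=
  {p | p.1 ∈ G.space ∧ p.2 ∈ G.space ∧ G.adjacent p.1 p.2}

/-- `G' ≼ G`: the guarantee `G` is stronger than `G'`. -/
def Guarantee.Weaker {D : Type*} (G' G : Guarantee D) : Prop :=
  G'.ind ⊆ G.ind ∧ G'.param ≤ G.param

/-- A mechanism `M`, given by the law `M X` of its output on `X`, is `(𝒟', A, f)`-DP. -/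
def Guarantee.SatisfiedBy {D : Type*} (G : Guarantee D) {Y : Type*} [MeasurableSpace Y]
    (M : D → ProbabilityMeasure Y) : Prop :=
  ∀ X ∈ G.space, ∀ X' ∈ G.space, G.adjacent X X' → G.param ≤ tradeoff (M X) (M X')

/-- The joint release `X ↦ (M₁ X, …, M_k X)`, the mechanisms being run independently. -/
def joint {D : Type*} {k : ℕ} {Y : Fin k → Type*} [∀ i, MeasurableSpace (Y i)]
    (M : ∀ i, D → ProbabilityMeasure (Y i)) (X : D) : ProbabilityMeasure (∀ i, Y i) :=
  ProbabilityMeasure.pi fun i => M i X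

/-! ### Invariants and the semi-adjacent parameter

A dataset is a finite sequence of records and a dataspace is a set of datasets. -/

/-- The invariant-conforming datasets `𝒟_t = {X ∈ 𝒟 : T X = t}`. -/
def conforming {D S : Type*} (T : D → S) (t : S) : Set D := {X | T X = t}

/-- The possible values `𝒟_t^i` of the record of individual `i` in the datasets of `Dt`. -/
def recordValues {𝒳 : Type*} {𝒟 : Set (List 𝒳)} (Dt : Set 𝒟) (i : ℕ) : Set 𝒳 :=
  {x | ∃ X ∈ Dt, X.1[i]? = some x}

/-- `sup_{i ∈ [n]} sup_{x, y ∈ 𝒟_t^i} inf {d X Y : X, Y ∈ 𝒟_t, X_i = x, Y_i = y}`. -/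
def semiAdjacentParameter {𝒳 : Type*} {𝒟 : Set (List 𝒳)} (d : 𝒟 → 𝒟 → ℕ) (Dt : Set 𝒟) (n : ℕ) :
    ℕ∞ :=
  ⨆ i : Fin n, ⨆ x ∈ recordValues Dt i, ⨆ y ∈ recordValues Dt i,
    sInf {m : ℕ∞ | ∃ X ∈ Dt, ∃ Y ∈ Dt, X.1[(i : ℕ)]? = some x ∧ Y.1[(i : ℕ)]? = some y ∧
      m = (d X Y : ℕ∞)}

end SemiDP

end

/-! Every tradeoff function `f` embeds in a chain: there are laws `R 0, R 1, …` on one space with `f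
≤ T(R j, R (j+1))` for all `j` and `T(R 0, R a) = f^[a]` for all `a` (`exists_chain`). Here `R j` is
the law of the `j`-fold iterated quantile map of `f` applied to a uniform variable, with
distribution function `f^[j]` below `1`.

Multiplying the chains of `f₁, …, f_k` gives a chain of product laws. Its steps dominate `G = f₁ ⊗ ⋯
⊗ f_k`, and its ends realize `F = f₁^{∘a} ⊗ ⋯ ⊗ f_k^{∘a}`. Group privacy along this chain
(`iterate_le_tradeoff_chain`) is therefore exactly `G^[a] ≤ F`. The privacy claims follow from group
privacy along chains of datasets.

All this rests on monotonicity of products (`tradeoff_pi_mono`), which also makes the tensor product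
well defined. It is proved by duality: the order on tradeoff functions is the reverse order on the
functionals `hockey`, which for products are integrals of `hockey` of one factor. -/

noncomputable section

namespace SemiDP

open MeasureTheory Set Filter

open scoped NNReal ENNReal Topology

section General

variable {Ω Ω' Ω'' : Type*} [MeasurableSpace Ω] [MeasurableSpace Ω'] [MeasurableSpace Ω'']

/-! ### Tests and elementary properties of tradeoff functions -/

/-- The rejection probability `E_P φ` of the test `φ` under `P`. -/
def power (P : ProbabilityMeasure Ω) (φ : Ω → I) : ℝ := ∫ ω, (φ ω : ℝ) ∂(P : Measure Ω)

theorem integrable_test (μ : Measure Ω) [IsFiniteMeasure μ] {φ : Ω → I} (hφ : Measurable φ) :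
    Integrable (fun ω => (φ ω : ℝ)) μ :=
  Integrable.of_bound (measurable_subtype_coe.comp hφ).aestronglyMeasurable 1
    (.of_forall fun ω => by simpa [abs_of_nonneg (φ ω).2.1] using (φ ω).2.2)

theorem power_nonneg (P : ProbabilityMeasure Ω) (φ : Ω → I) : 0 ≤ power P φ :=
  integral_nonneg fun ω => (φ ω).2.1

theorem power_le_one (P : ProbabilityMeasure Ω) {φ : Ω → I} (hφ : Measurable φ) :
    power P φ ≤ 1 := by
  simpa [power] using integral_mono (integrable_test (P : Measure Ω) hφ) (integrable_const (1 : ℝ))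
    fun ω => (φ ω).2.2

theorem power_map (P : ProbabilityMeasure Ω) {g : Ω → Ω'} (hg : Measurable g) {φ : Ω' → I}
    (hφ : Measurable φ) : power (P.map hg.aemeasurable) φ = power P (φ ∘ g) :=
  integral_map hg.aemeasurable (measurable_subtype_coe.comp hφ).aestronglyMeasurable

theorem tradeoff_le (P Q : ProbabilityMeasure Ω) {α : I} {φ : Ω → I} (hφ : Measurable φ)
    (h : power P φ ≤ 1 - α) : (tradeoff P Q α : ℝ) ≤ 1 - power Q φ :=
  csInf_le ⟨0, typeTwoErrors_nonneg P Q α⟩ ⟨φ, hφ, h, rfl⟩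

theorem le_tradeoff {P Q : ProbabilityMeasure Ω} {α : I} {c : ℝ}
    (h : ∀ φ : Ω → I, Measurable φ → power P φ ≤ 1 - α → c ≤ 1 - power Q φ) :
    c ≤ tradeoff P Q α := by
  refine le_csInf ⟨1, one_mem_typeTwoErrors P Q α⟩ ?_
  rintro β ⟨φ, hφ, h', rfl⟩
  exact h φ hφ h'

theorem exists_test_lt (P Q : ProbabilityMeasure Ω) (α : I) {c : ℝ} (hc : tradeoff P Q α < c) :
    ∃ φ : Ω → I, Measurable φ ∧ power P φ ≤ 1 - α ∧ 1 - power Q φ < c := by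
  obtain ⟨β, ⟨φ, hφ, h, rfl⟩, h'⟩ :=
    exists_lt_of_csInf_lt ⟨1, one_mem_typeTwoErrors P Q α⟩ hc
  exact ⟨φ, hφ, h, h'⟩

theorem tradeoff_mono (P Q : ProbabilityMeasure Ω) : Monotone (tradeoff P Q) := fun _ β h =>
  le_tradeoff fun _ hφ hP => tradeoff_le P Q hφ
    (hP.trans (sub_le_sub_left (show (_ : ℝ) ≤ (β : ℝ) from h) 1))

theorem tradeoff_le_self (P Q : ProbabilityMeasure Ω) (α : I) : tradeoff P Q α ≤ α := by
  have h := tradeoff_le P Q (α := α) (φ := fun _ => σ α) measurable_const (by simp [power])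
  simpa [power] using h

theorem tradeoff_self (P : ProbabilityMeasure Ω) : tradeoff P P = id := by
  ext α
  refine le_antisymm (tradeoff_le_self P P α) (le_tradeoff fun φ _ h => ?_)
  simp only [id]
  linarith

/-- Data processing: a common measurable map makes two laws harder to distinguish. -/
theorem tradeoff_le_tradeoff_map (P Q : ProbabilityMeasure Ω) {g : Ω → Ω'} (hg : Measurable g) :
    tradeoff P Q ≤ tradeoff (P.map hg.aemeasurable) (Q.map hg.aemeasurable) := fun α =>
  le_tradeoff fun φ hφ h => by
    rw [power_map Q hg hφ]
    rw [power_map P hg hφ] at h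
    exact tradeoff_le P Q (hφ.comp hg) h

/-- The type II error of a test of `P` against `Q` is its level parameter as a test of `Q` against
`R`. -/
theorem tradeoff_trans {P Q R : ProbabilityMeasure Ω} {f g : I → I} (hg : Monotone g)
    (hf : f ≤ tradeoff P Q) (hg' : g ≤ tradeoff Q R) : g ∘ f ≤ tradeoff P R := fun α => by
  refine le_tradeoff fun φ hφ h => ?_
  have h1 : (f α : ℝ) ≤ 1 - power Q φ := le_trans (hf α) (tradeoff_le P Q hφ h)
  let β : I := ⟨1 - power Q φ, by linarith [power_le_one Q hφ], by linarith [power_nonneg Q φ]⟩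
  have h2 : (g β : ℝ) ≤ 1 - power R φ :=
    le_trans (hg' β) (tradeoff_le Q R hφ (by simp [β]))
  exact le_trans (hg (show f α ≤ β from h1)) h2

theorem iterate_le_tradeoff_chain {f : I → I} (hf : Monotone f) {p : ℕ → ProbabilityMeasure Ω}
    (m : ℕ) (h : ∀ j < m, f ≤ tradeoff (p j) (p (j + 1))) :
    f^[m] ≤ tradeoff (p 0) (p m) := by
  induction m with
  | zero => simp [tradeoff_self]
  | succ m ih =>
    rw [Function.iterate_succ']
    exact tradeoff_trans hf (ih fun j hj => h j (hj.trans m.lt_succ_self)) (h m m.lt_succ_self)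

theorem iterate_le_iterate {f : I → I} (hf : ∀ x, f x ≤ x) {m a : ℕ} (h : m ≤ a) :
    f^[a] ≤ f^[m] := by
  obtain ⟨c, rfl⟩ := Nat.exists_eq_add_of_le' h
  intro x
  rw [Function.iterate_add_apply]
  generalize f^[m] x = y
  induction c with
  | zero => exact le_rfl
  | succ c ih =>
    rw [Function.iterate_succ_apply']
    exact (hf _).trans (ih (by omega))

/-- Group privacy along chains of adjacent datasets. -/
theorem satisfiedBy_iterate {D : Type*} {d : D → D → ℕ} (hd : IsAdjacencyMetric d)
    {f : I → I} (hf : Monotone f) (hf' : ∀ x, f x ≤ x) {M : D → ProbabilityMeasure Ω}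
    (hM : (Guarantee.mk Set.univ (adj d 1) f).SatisfiedBy M) (s : Set D) (a : ℕ) :
    (Guarantee.mk s (adj d a) f^[a]).SatisfiedBy M := by
  intro X _ X' _ hXX'
  -- The chain has length `d X X' ≤ a` and may leave `s`, so the guarantee on all of `D` is what
  -- applies.
  obtain ⟨⟨p, h0, h1, hp⟩, -⟩ := (hd.chain X X' _).1 rfl
  have h := iterate_le_tradeoff_chain hf (p := fun j => M (p j)) _ fun j hj =>
    hM _ trivial _ trivial (hp j hj).le
  rw [h0, h1] at h
  exact (iterate_le_iterate hf' hXX').trans h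

/-- Mix nearly optimal tests at `α` and `β` with weights `c` and `1 - c`. -/
theorem tradeoff_convex (P Q : ProbabilityMeasure Ω) (α β γ : I) (c : ℝ) (hc0 : 0 ≤ c)
    (hc1 : c ≤ 1) (h : (γ : ℝ) = c * α + (1 - c) * β) :
    (tradeoff P Q γ : ℝ) ≤ c * tradeoff P Q α + (1 - c) * tradeoff P Q β := by
  refine le_of_forall_pos_le_add fun ε hε => ?_
  obtain ⟨φ, hφ, h1, h2⟩ := exists_test_lt P Q α (lt_add_of_pos_right _ hε)
  obtain ⟨ψ, hψ, h3, h4⟩ := exists_test_lt P Q β (lt_add_of_pos_right _ hε)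
  let χ : Ω → I := fun ω => ⟨c * φ ω + (1 - c) * ψ ω,
    add_nonneg (mul_nonneg hc0 (φ ω).2.1) (mul_nonneg (by linarith) (ψ ω).2.1), by
      nlinarith [(φ ω).2.2, (ψ ω).2.2]⟩
  have hχ : Measurable χ := by
    refine Measurable.subtype_mk ?_
    exact ((measurable_subtype_coe.comp hφ).const_mul c).add
      ((measurable_subtype_coe.comp hψ).const_mul (1 - c))
  have hp (R : ProbabilityMeasure Ω) : power R χ = c * power R φ + (1 - c) * power R ψ := by
    simp only [power, χ]
    rw [integral_add ((integrable_test _ hφ).const_mul _) ((integrable_test _ hψ).const_mul _),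
      integral_const_mul, integral_const_mul]
  have := tradeoff_le P Q (α := γ) hχ (by rw [hp, h]; nlinarith)
  rw [hp] at this
  nlinarith

/-! ### The hockey-stick functional and its duality with the tradeoff function -/

/-- The largest value of `s E_Q φ - t E_P φ` over all tests `φ`. -/
def hockey (P Q : ProbabilityMeasure Ω) (s t : ℝ) : ℝ :=
  sSup {x | ∃ φ : Ω → I, Measurable φ ∧ x = s * power Q φ - t * power P φ}

theorem le_hockey (P Q : ProbabilityMeasure Ω) (s t : ℝ) {φ : Ω → I} (hφ : Measurable φ) :
    s * power Q φ - t * power P φ ≤ hockey P Q s t := by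
  refine le_csSup ⟨|s| + |t|, ?_⟩ ⟨φ, hφ, rfl⟩
  rintro _ ⟨ψ, hψ, rfl⟩
  have := abs_le.1 (abs_mul s (power Q ψ)).le
  have := abs_le.1 (abs_mul t (power P ψ)).le
  have h1 := mul_le_mul_of_nonneg_left (power_le_one Q hψ) (abs_nonneg s)
  have h2 := mul_le_mul_of_nonneg_left (power_le_one P hψ) (abs_nonneg t)
  rw [abs_of_nonneg (power_nonneg _ _)] at *
  linarith

theorem hockey_le {P Q : ProbabilityMeasure Ω} {s t c : ℝ}
    (h : ∀ φ : Ω → I, Measurable φ → s * power Q φ - t * power P φ ≤ c) : hockey P Q s t ≤ c := by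
  refine csSup_le ⟨_, fun _ => 0, measurable_const, rfl⟩ ?_
  rintro _ ⟨φ, hφ, rfl⟩
  exact h φ hφ

/-- `P + Q` dominates both laws; the densities are made finite everywhere. -/
theorem exists_densities (P Q : ProbabilityMeasure Ω) :
    ∃ μ : Measure Ω, IsFiniteMeasure μ ∧ ∃ p q : Ω → ℝ≥0, Measurable p ∧ Measurable q ∧
      (P : Measure Ω) = μ.withDensity (fun ω => p ω) ∧
      (Q : Measure Ω) = μ.withDensity (fun ω => q ω) := by
  have key (μ ν : Measure Ω) [IsFiniteMeasure μ] [IsFiniteMeasure ν] (h : ν ≪ μ) :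
      ν = μ.withDensity (fun ω => ((ν.rnDeriv μ ω).toNNReal : ℝ≥0∞)) := by
    conv_lhs => rw [← Measure.withDensity_rnDeriv_eq ν μ h]
    refine withDensity_congr_ae ?_
    filter_upwards [ν.rnDeriv_lt_top μ] with ω hω
    exact (ENNReal.coe_toNNReal hω.ne).symm
  refine ⟨(P : Measure Ω) + Q, inferInstance, _, _,
    (Measure.measurable_rnDeriv _ _).ennreal_toNNReal,
    (Measure.measurable_rnDeriv _ _).ennreal_toNNReal, key _ _ ?_, key _ _ ?_⟩
  · exact (Measure.le_add_right le_rfl).absolutelyContinuous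
  · exact (Measure.le_add_left le_rfl).absolutelyContinuous

/-! ### Likelihood-ratio tests and the integral formula for `hockey` -/

section Density

variable {P Q : ProbabilityMeasure Ω} {μ : Measure Ω} {p q : Ω → ℝ≥0}

theorem integrable_density (hp : Measurable p) (hP : (P : Measure Ω) = μ.withDensity fun ω => p ω) :
    Integrable (fun ω => (p ω : ℝ)) μ := by
  refine ⟨(measurable_coe_nnreal_real.comp hp).aestronglyMeasurable, ?_⟩
  have h : ∫⁻ ω, (p ω : ℝ≥0∞) ∂μ = 1 := by
    rw [← setLIntegral_univ, ← withDensity_apply _ MeasurableSet.univ, ← hP, measure_univ]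
  simp [HasFiniteIntegral, enorm_eq_nnnorm, h]

theorem power_eq_integral_density (hp : Measurable p)
    (hP : (P : Measure Ω) = μ.withDensity fun ω => p ω) (φ : Ω → I) :
    power P φ = ∫ ω, (p ω : ℝ) * φ ω ∂μ := by
  rw [power, hP, integral_withDensity_eq_integral_smul hp]
  rfl

theorem integrable_density_mul (hp : Measurable p)
    (hP : (P : Measure Ω) = μ.withDensity fun ω => p ω) {φ : Ω → I} (hφ : Measurable φ) :
    Integrable (fun ω => (p ω : ℝ) * φ ω) μ := by
  refine (integrable_density hp hP).mono
    ((measurable_coe_nnreal_real.comp hp).mul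
      (measurable_subtype_coe.comp hφ)).aestronglyMeasurable (.of_forall fun ω => ?_)
  rw [norm_mul]
  exact mul_le_of_le_one_right (norm_nonneg _)
    (by simpa [abs_of_nonneg (φ ω).2.1] using (φ ω).2.2)

theorem power_sub_eq_integral (hp : Measurable p) (hq : Measurable q)
    (hP : (P : Measure Ω) = μ.withDensity fun ω => p ω)
    (hQ : (Q : Measure Ω) = μ.withDensity fun ω => q ω) (s t : ℝ) {φ : Ω → I}
    (hφ : Measurable φ) :
    s * power Q φ - t * power P φ = ∫ ω, (s * q ω - t * p ω) * φ ω ∂μ := by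
  rw [power_eq_integral_density hp hP, power_eq_integral_density hq hQ, ← integral_const_mul,
    ← integral_const_mul, ← integral_sub ((integrable_density_mul hq hQ hφ).const_mul s)
      ((integrable_density_mul hp hP hφ).const_mul t)]
  congr with ω
  ring

theorem integrable_hockey (hp : Measurable p) (hq : Measurable q)
    (hP : (P : Measure Ω) = μ.withDensity fun ω => p ω)
    (hQ : (Q : Measure Ω) = μ.withDensity fun ω => q ω) (s t : ℝ) :
    Integrable (fun ω => max (s * q ω - t * p ω) 0) μ :=
  (((integrable_density hq hQ).const_mul s).sub ((integrable_density hp hP).const_mul t)).pos_part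

/-- The test that rejects where the likelihood ratio exceeds the threshold. -/
def neymanPearson (p q : Ω → ℝ≥0) (s t : ℝ) (ω : Ω) : I :=
  open Classical in if 0 < s * q ω - t * p ω then 1 else 0

theorem measurable_neymanPearson (hp : Measurable p) (hq : Measurable q) (s t : ℝ) :
    Measurable (neymanPearson p q s t) := by
  refine Measurable.ite (measurableSet_lt measurable_const ?_) measurable_const measurable_const
  fun_prop

theorem hockey_integrand {Z : Type*} (p q : Z → ℝ≥0) (s t : ℝ) (ω : Z) :
    (s * q ω - t * p ω) * neymanPearson p q s t ω = max (s * q ω - t * p ω) 0 := by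
  unfold neymanPearson
  split_ifs with h
  · simp [max_eq_left h.le]
  · simp [max_eq_right (not_lt.1 h)]

theorem power_sub_neymanPearson (hp : Measurable p) (hq : Measurable q)
    (hP : (P : Measure Ω) = μ.withDensity fun ω => p ω)
    (hQ : (Q : Measure Ω) = μ.withDensity fun ω => q ω) (s t : ℝ) :
    s * power Q (neymanPearson p q s t) - t * power P (neymanPearson p q s t) =
      ∫ ω, max (s * q ω - t * p ω) 0 ∂μ := by
  rw [power_sub_eq_integral hp hq hP hQ s t (measurable_neymanPearson hp hq s t)]
  simp_rw [hockey_integrand]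

/-- The integrand `(s q - t p) φ` is maximized pointwise by the likelihood-ratio test. -/
theorem hockey_eq_integral (hp : Measurable p) (hq : Measurable q)
    (hP : (P : Measure Ω) = μ.withDensity fun ω => p ω)
    (hQ : (Q : Measure Ω) = μ.withDensity fun ω => q ω) (s t : ℝ) :
    hockey P Q s t = ∫ ω, max (s * q ω - t * p ω) 0 ∂μ := by
  refine le_antisymm (hockey_le fun φ hφ => ?_) ?_
  · rw [power_sub_eq_integral hp hq hP hQ s t hφ]
    refine integral_mono (((integrable_density_mul hq hQ hφ).const_mul s).sub
      ((integrable_density_mul hp hP hφ).const_mul t) |>.congr (.of_forall fun ω => ?_))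
      (integrable_hockey hp hq hP hQ s t) fun ω => ?_
    · simp only [Pi.sub_apply]
      ring
    · exact (mul_le_mul_of_nonneg_right (le_max_left _ 0) (φ ω).2.1).trans
        (mul_le_of_le_one_right (le_max_right _ _) (φ ω).2.2)
  · rw [← power_sub_neymanPearson hp hq hP hQ]
    exact le_hockey P Q s t (measurable_neymanPearson hp hq s t)

end Density

theorem hockey_mono_of_tradeoff_le {P Q : ProbabilityMeasure Ω} {P' Q' : ProbabilityMeasure Ω'}
    (h : tradeoff P Q ≤ tradeoff P' Q') {s t : ℝ} (hs : 0 ≤ s) (ht : 0 ≤ t) :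
    hockey P' Q' s t ≤ hockey P Q s t := by
  refine hockey_le fun φ hφ => ?_
  let α : I := ⟨1 - power P' φ, by linarith [power_le_one P' hφ], by linarith [power_nonneg P' φ]⟩
  have h1 : (tradeoff P Q α : ℝ) ≤ 1 - power Q' φ :=
    le_trans (h α) (tradeoff_le P' Q' hφ (by simp [α]))
  refine le_of_forall_pos_le_add fun ε hε => ?_
  -- The error is later multiplied by `s`, which may vanish; hence the denominator `s + 1`.
  obtain ⟨ψ, hψ, h2, h3⟩ := exists_test_lt P Q α (c := tradeoff P Q α + ε / (s + 1))
    (lt_add_of_pos_right _ (by positivity))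
  have h4 := le_hockey P Q s t hψ
  have h5 : power P ψ ≤ power P' φ := by simpa [α] using h2
  have h6 : power Q' φ ≤ power Q ψ + ε / (s + 1) := by linarith
  have h7 := mul_le_mul_of_nonneg_left h6 hs
  have h8 := mul_le_mul_of_nonneg_left h5 ht
  have h9 : s * (ε / (s + 1)) ≤ ε := by
    rw [mul_div_assoc', div_le_iff₀ (by positivity)]
    nlinarith
  rw [mul_add] at h7
  linarith

theorem one_sub_le_tradeoff (P Q : ProbabilityMeasure Ω) (α : I) {γ : ℝ} (hγ : 0 ≤ γ) :
    1 - hockey P Q 1 γ - γ * (1 - α) ≤ tradeoff P Q α := by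
  refine le_tradeoff fun φ hφ h => ?_
  have h1 := le_hockey P Q 1 γ hφ
  have h2 := mul_le_mul_of_nonneg_left h hγ
  linarith

/-- Converse of `one_sub_le_tradeoff`: a line of slope `γ` below the tradeoff function, with value
`c` at `1`, bounds the functional. -/
theorem hockey_le_of_support {P Q : ProbabilityMeasure Ω} {γ c : ℝ}
    (h : ∀ β : I, c - γ * (1 - β) ≤ tradeoff P Q β) : hockey P Q 1 γ ≤ 1 - c := by
  refine hockey_le fun φ hφ => ?_
  let α : I := ⟨1 - power P φ, by linarith [power_le_one P hφ], by linarith [power_nonneg P φ]⟩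
  have h1 := h α
  have h2 := tradeoff_le P Q (α := α) hφ (by simp [α])
  simp only [α] at h1 h2
  linarith

/-- The extension of `f : [0,1] → [0,1]` to the real line by constants. -/
def realExt (f : I → I) (x : ℝ) : ℝ := f (projIcc 0 1 zero_le_one x)

theorem realExt_coe (f : I → I) (x : I) : realExt f x = f x := by
  simp [realExt]

theorem realExt_of_mem (f : I → I) {x : ℝ} (hx : x ∈ Icc (0 : ℝ) 1) : realExt f x = f ⟨x, hx⟩ := by
  rw [realExt, projIcc_of_mem]

theorem realExt_monotone {f : I → I} (hf : Monotone f) : Monotone (realExt f) := fun _ _ h =>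
  hf (monotone_projIcc _ h)

theorem convexOn_realExt_tradeoff (P Q : ProbabilityMeasure Ω) :
    ConvexOn ℝ (Icc 0 1) (realExt (tradeoff P Q)) := by
  refine ⟨convex_Icc 0 1, fun x hx y hy a b ha hb hab => ?_⟩
  have hz : a • x + b • y ∈ Icc (0 : ℝ) 1 := convex_Icc 0 1 hx hy ha hb hab
  rw [realExt_of_mem _ hx, realExt_of_mem _ hy, realExt_of_mem _ hz]
  obtain rfl : b = 1 - a := by linarith
  exact tradeoff_convex P Q ⟨x, hx⟩ ⟨y, hy⟩ ⟨_, hz⟩ a ha (by linarith) rfl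

theorem rightDeriv_realExt_nonneg {f : I → I} (hf : Monotone f) (x : ℝ) :
    0 ≤ derivWithin (realExt f) (Ioi x) x :=
  ((realExt_monotone hf).monotoneOn _).derivWithin_nonneg

theorem exists_support {f : I → I} (hf : Monotone f) (hc : ConvexOn ℝ (Icc 0 1) (realExt f))
    {α : I} (h0 : 0 < (α : ℝ)) (h1 : (α : ℝ) < 1) :
    ∃ γ : ℝ, 0 ≤ γ ∧ ∀ β : I, f α + γ * (β - α) ≤ (f β : ℝ) := by
  have hi : (α : ℝ) ∈ interior (Icc (0 : ℝ) 1) := by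
    rw [interior_Icc]
    exact ⟨h0, h1⟩
  refine ⟨_, rightDeriv_realExt_nonneg hf α, fun β => ?_⟩
  rcases lt_trichotomy (α : ℝ) β with h | h | h
  · have h2 := hc.rightDeriv_le_slope_of_mem_interior hi β.2 h
    rw [slope_def_field, le_div_iff₀ (sub_pos.2 h), realExt_coe, realExt_coe] at h2
    linarith
  · obtain rfl := Subtype.ext h
    simp
  · have h2 := (hc.slope_le_leftDeriv_of_mem_interior β.2 hi h).trans
      (hc.leftDeriv_le_rightDeriv_of_mem_interior hi)
    rw [slope_def_field, div_le_iff₀ (sub_pos.2 h), realExt_coe, realExt_coe] at h2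
    linarith

/-- As `γ → ∞` the functional tends to `Q(p = 0)`, and the test `1_{p = 0}` has `P`-power zero. This
replaces a supporting line at `1`, where the slope may be infinite. -/
theorem exists_hockey_lt (P Q : ProbabilityMeasure Ω) {ε : ℝ} (hε : 0 < ε) :
    ∃ γ : ℝ, 0 ≤ γ ∧ hockey P Q 1 γ < 1 - tradeoff P Q 1 + ε := by
  obtain ⟨μ, _, p, q, hp, hq, hP, hQ⟩ := exists_densities P Q
  let s : Set Ω := {ω | p ω = 0}
  have hs : MeasurableSet s := hp (measurableSet_singleton 0)
  classical
  let ψ : Ω → I := s.indicator 1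
  have hψ : Measurable ψ := measurable_one.indicator hs
  have hPψ : power P ψ = 0 := by
    rw [power_eq_integral_density hp hP]
    refine integral_eq_zero_of_ae (.of_forall fun ω => ?_)
    by_cases h : ω ∈ s
    · have : p ω = 0 := h
      simp [this]
    · simp [ψ, h]
  have hT := tradeoff_le P Q (α := 1) hψ (by simp [hPψ])
  have hlim : Tendsto (fun n : ℕ => hockey P Q 1 n) atTop (𝓝 (power Q ψ)) := by
    rw [power_eq_integral_density hq hQ]
    simp_rw [hockey_eq_integral hp hq hP hQ]
    refine tendsto_integral_of_dominated_convergence (fun ω => (q ω : ℝ))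
      (fun n => (integrable_hockey hp hq hP hQ 1 n).aestronglyMeasurable)
      (integrable_density hq hQ) (fun n => .of_forall fun ω => ?_) (.of_forall fun ω => ?_)
    · rw [Real.norm_of_nonneg (le_max_right _ _), one_mul]
      exact max_le (sub_le_self _ (by positivity)) (by positivity)
    · by_cases h : ω ∈ s
      · have h' : p ω = 0 := h
        simp [ψ, h, h']
      · have h' : 0 < (p ω : ℝ) := by
          exact NNReal.coe_pos.2 (pos_iff_ne_zero.2 h)
        refine tendsto_const_nhds.congr' ?_
        have := (tendsto_natCast_atTop_atTop (R := ℝ)).atTop_mul_const h'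
        filter_upwards [this.eventually_ge_atTop (q ω : ℝ)] with n hn
        simp [ψ, h, hn]
  obtain ⟨n, hn⟩ := (hlim.eventually_lt_const (lt_add_of_pos_right _ hε)).exists
  exact ⟨n, by positivity, by linarith⟩

theorem tradeoff_one_le (P Q : ProbabilityMeasure Ω) {ε : ℝ} (hε : 0 < ε) :
    ∃ γ : ℝ, 0 ≤ γ ∧ ∀ α : I, tradeoff P Q 1 - ε - γ * (1 - α) ≤ (tradeoff P Q α : ℝ) := by
  obtain ⟨γ, hγ, h⟩ := exists_hockey_lt P Q hε
  exact ⟨γ, hγ, fun α => by linarith [one_sub_le_tradeoff P Q α hγ]⟩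

theorem tradeoff_one_le_of_forall_lt (P Q : ProbabilityMeasure Ω) {c : ℝ}
    (h : ∀ α : I, 0 < (α : ℝ) → (α : ℝ) < 1 → (tradeoff P Q α : ℝ) ≤ c) :
    (tradeoff P Q 1 : ℝ) ≤ c := by
  refine le_of_forall_pos_le_add fun ε hε => ?_
  obtain ⟨γ, hγ, hγ'⟩ := tradeoff_one_le P Q (half_pos hε)
  -- The distance `δ` to `1` is chosen so that `δ < 1` and `γ δ ≤ ε / 2`.
  have hδ : 0 < ε / (2 * (ε + γ + 1)) := by positivity
  have hδ1 : ε / (2 * (ε + γ + 1)) < 1 := by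
    rw [div_lt_one (by positivity)]
    linarith
  have hδ2 : γ * (ε / (2 * (ε + γ + 1))) ≤ ε / 2 := by
    rw [mul_div_assoc', div_le_div_iff₀ (by positivity) (by positivity)]
    nlinarith
  let α : I := ⟨1 - ε / (2 * (ε + γ + 1)), by linarith, by linarith⟩
  have h1 := h α (by simp [α, hδ1]) (by simp [α, hδ])
  have h2 := hγ' α
  simp only [α, sub_sub_cancel] at h1 h2
  linarith

/-- Convexity gives continuity inside, `T(α) ≤ α` gives it at `0`, and the approximate supporting
lines give it at `1`. -/
theorem continuous_tradeoff (P Q : ProbabilityMeasure Ω) : Continuous (tradeoff P Q) := by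
  have hm := realExt_monotone (tradeoff_mono P Q)
  have hc : ContinuousOn (realExt (tradeoff P Q)) (Icc 0 1) := by
    refine (convexOn_realExt_tradeoff P Q).continuousOn_Icc one_pos ?_ ?_
    · have h0 : realExt (tradeoff P Q) 0 = 0 :=
        le_antisymm (by rw [realExt, projIcc_left]; exact tradeoff_le_self P Q 0)
          (tradeoff P Q _).2.1
      rw [ContinuousWithinAt, h0]
      have h1 : Tendsto (fun x : ℝ => (projIcc (0 : ℝ) 1 zero_le_one x : ℝ)) (𝓝[≥] 0) (𝓝 0) := by
        have : Continuous fun x : ℝ => (projIcc (0 : ℝ) 1 zero_le_one x : ℝ) :=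
          continuous_subtype_val.comp continuous_projIcc
        simpa using (this.tendsto 0).mono_left nhdsWithin_le_nhds
      exact tendsto_of_tendsto_of_tendsto_of_le_of_le tendsto_const_nhds h1
        (fun x => (tradeoff P Q _).2.1) fun x => tradeoff_le_self P Q _
    · refine tendsto_order.2 ⟨fun a ha => ?_, fun a ha => ?_⟩
      · obtain ⟨α, -, h1, h2⟩ : ∃ α : I, 0 < (α : ℝ) ∧ (α : ℝ) < 1 ∧ a < tradeoff P Q α := by
          by_contra! h
          have h3 := tradeoff_one_le_of_forall_lt P Q h
          rw [realExt, projIcc_right] at ha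
          exact ha.not_ge h3
        filter_upwards [nhdsWithin_le_nhds (lt_mem_nhds h1)] with x hx
        rw [← realExt_coe] at h2
        exact h2.trans_le (hm hx.le)
      · filter_upwards [self_mem_nhdsWithin] with x hx
        exact (hm hx).trans_lt ha
  have : tradeoff P Q = fun x : I => projIcc (0 : ℝ) 1 zero_le_one (realExt (tradeoff P Q) x) := by
    ext x
    simp [realExt_coe]
  rw [this]
  exact continuous_projIcc.comp (hc.comp_continuous continuous_subtype_val fun x => x.2)

/-- Strong duality: the hockey-stick functional determines the tradeoff function. -/
theorem tradeoff_le_of_hockey_le {P Q : ProbabilityMeasure Ω} {P' Q' : ProbabilityMeasure Ω'}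
    (h : ∀ γ : ℝ, 0 ≤ γ → hockey P' Q' 1 γ ≤ hockey P Q 1 γ) :
    tradeoff P Q ≤ tradeoff P' Q' := by
  have key (α : I) (h0 : 0 < (α : ℝ)) (h1 : (α : ℝ) < 1) :
      (tradeoff P Q α : ℝ) ≤ tradeoff P' Q' α := by
    obtain ⟨γ, hγ, hs⟩ :=
      exists_support (tradeoff_mono P Q) (convexOn_realExt_tradeoff P Q) h0 h1
    -- `c` is the value at `1` of the supporting line at `α`.
    have h2 := hockey_le_of_support (P := P) (Q := Q) (γ := γ)
      (c := tradeoff P Q α + γ * (1 - α)) fun β => by linarith [hs β]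
    linarith [one_sub_le_tradeoff P' Q' α hγ, h γ hγ]
  intro α
  show (tradeoff P Q α : ℝ) ≤ tradeoff P' Q' α
  rcases α.2.1.eq_or_lt with h0 | h0
  · obtain rfl : α = 0 := Subtype.ext h0.symm
    exact (tradeoff_le_self P Q 0 : _).trans (tradeoff P' Q' 0).2.1
  · rcases α.2.2.eq_or_lt with h1 | h1
    · obtain rfl : α = 1 := Subtype.ext h1
      exact tradeoff_one_le_of_forall_lt P Q fun β hβ hβ' =>
        (key β hβ hβ').trans (tradeoff_mono P' Q' β.2.2)
    · exact key α h0 h1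

/-! ### Products -/

/-- Product densities factor, so Fubini leaves `hockey` of the first pair with weights scaled by `q
y` and `p y`; this is why it carries two weights. -/
theorem hockey_prod {P Q : ProbabilityMeasure Ω} {P' Q' : ProbabilityMeasure Ω'}
    {μ : Measure Ω'} [IsFiniteMeasure μ] {p q : Ω' → ℝ≥0} (hp : Measurable p) (hq : Measurable q)
    (hP : (P' : Measure Ω') = μ.withDensity fun ω => p ω)
    (hQ : (Q' : Measure Ω') = μ.withDensity fun ω => q ω) (s t : ℝ) :
    Integrable (fun y => hockey P Q (s * q y) (t * p y)) μ ∧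
    hockey (P.prod P') (Q.prod Q') s t = ∫ y, hockey P Q (s * q y) (t * p y) ∂μ := by
  obtain ⟨ν, _, p₁, q₁, hp₁, hq₁, hP₁, hQ₁⟩ := exists_densities P Q
  have hpp : Measurable fun z : Ω × Ω' => p₁ z.1 * p z.2 := by fun_prop
  have hqq : Measurable fun z : Ω × Ω' => q₁ z.1 * q z.2 := by fun_prop
  have hPP : (P.prod P' : Measure (Ω × Ω')) =
      (ν.prod μ).withDensity fun z => ((p₁ z.1 * p z.2 : ℝ≥0) : ℝ≥0∞) := by
    rw [ProbabilityMeasure.toMeasure_prod, hP₁, hP,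
      prod_withDensity hp₁.coe_nnreal_ennreal hp.coe_nnreal_ennreal]
    simp
  have hQQ : (Q.prod Q' : Measure (Ω × Ω')) =
      (ν.prod μ).withDensity fun z => ((q₁ z.1 * q z.2 : ℝ≥0) : ℝ≥0∞) := by
    rw [ProbabilityMeasure.toMeasure_prod, hQ₁, hQ,
      prod_withDensity hq₁.coe_nnreal_ennreal hq.coe_nnreal_ennreal]
    simp
  have hi := integrable_hockey hpp hqq hPP hQQ s t
  have he (y : Ω') : hockey P Q (s * q y) (t * p y) =
      ∫ x, max (s * (q₁ x * q y : ℝ≥0) - t * (p₁ x * p y : ℝ≥0)) 0 ∂ν := by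
    rw [hockey_eq_integral hp₁ hq₁ hP₁ hQ₁]
    congr with x
    push_cast
    ring_nf
  simp_rw [he]
  exact ⟨hi.integral_prod_right,
    (hockey_eq_integral hpp hqq hPP hQQ s t).trans (integral_prod_symm _ hi)⟩

theorem tradeoff_prod_mono_left {P Q : ProbabilityMeasure Ω} {P' Q' : ProbabilityMeasure Ω'}
    (h : tradeoff P Q ≤ tradeoff P' Q') (R S : ProbabilityMeasure Ω'') :
    tradeoff (P.prod R) (Q.prod S) ≤ tradeoff (P'.prod R) (Q'.prod S) := by
  obtain ⟨μ, _, p, q, hp, hq, hP, hQ⟩ := exists_densities R S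
  refine tradeoff_le_of_hockey_le fun γ hγ => ?_
  obtain ⟨hi, he⟩ := hockey_prod (P := P) (Q := Q) hp hq hP hQ 1 γ
  obtain ⟨hi', he'⟩ := hockey_prod (P := P') (Q := Q') hp hq hP hQ 1 γ
  rw [he, he']
  exact integral_mono hi' hi fun y => hockey_mono_of_tradeoff_le h (by positivity) (by positivity)

theorem tradeoff_prod_swap_le (P Q : ProbabilityMeasure Ω) (R S : ProbabilityMeasure Ω') :
    tradeoff (P.prod R) (Q.prod S) ≤ tradeoff (R.prod P) (S.prod Q) := by
  have := tradeoff_le_tradeoff_map (P.prod R) (Q.prod S) measurable_swap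
  rwa [ProbabilityMeasure.prod_swap, ProbabilityMeasure.prod_swap] at this

theorem tradeoff_prod_mono {Ω₁ Ω₂ : Type*} [MeasurableSpace Ω₁] [MeasurableSpace Ω₂]
    {P Q : ProbabilityMeasure Ω} {P' Q' : ProbabilityMeasure Ω'}
    {R S : ProbabilityMeasure Ω₁} {R' S' : ProbabilityMeasure Ω₂}
    (h : tradeoff P Q ≤ tradeoff P' Q') (h' : tradeoff R S ≤ tradeoff R' S') :
    tradeoff (P.prod R) (Q.prod S) ≤ tradeoff (P'.prod R') (Q'.prod S') :=
  calc tradeoff (P.prod R) (Q.prod S) ≤ tradeoff (P'.prod R) (Q'.prod S) :=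
        tradeoff_prod_mono_left h R S
    _ ≤ tradeoff (R.prod P') (S.prod Q') := tradeoff_prod_swap_le _ _ _ _
    _ ≤ tradeoff (R'.prod P') (S'.prod Q') := tradeoff_prod_mono_left h' _ _
    _ ≤ _ := tradeoff_prod_swap_le _ _ _ _

theorem map_piFinSuccAbove {k : ℕ} {X : Fin (k + 1) → Type*} [∀ i, MeasurableSpace (X i)]
    (P : ∀ i, ProbabilityMeasure (X i)) :
    (ProbabilityMeasure.pi P).map (MeasurableEquiv.piFinSuccAbove X 0).measurable.aemeasurable =
      (P 0).prod (ProbabilityMeasure.pi fun j => P (Fin.succAbove 0 j)) :=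
  Subtype.ext (measurePreserving_piFinSuccAbove (fun i => (P i : Measure (X i))) 0).map_eq

theorem map_piFinSuccAbove_symm {k : ℕ} {X : Fin (k + 1) → Type*} [∀ i, MeasurableSpace (X i)]
    (P : ∀ i, ProbabilityMeasure (X i)) :
    ((P 0).prod (ProbabilityMeasure.pi fun j => P (Fin.succAbove 0 j))).map
      (MeasurableEquiv.piFinSuccAbove X 0).symm.measurable.aemeasurable = ProbabilityMeasure.pi P :=
  Subtype.ext ((measurePreserving_piFinSuccAbove (fun i => (P i : Measure (X i))) 0).symm _).map_eq

/-- The tradeoff function of a product is monotone in those of the factors. -/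
theorem tradeoff_pi_mono {k : ℕ} {X : Fin k → Type*} {X' : Fin k → Type*}
    [∀ i, MeasurableSpace (X i)] [∀ i, MeasurableSpace (X' i)]
    {P Q : ∀ i, ProbabilityMeasure (X i)} {P' Q' : ∀ i, ProbabilityMeasure (X' i)}
    (h : ∀ i, tradeoff (P i) (Q i) ≤ tradeoff (P' i) (Q' i)) :
    tradeoff (ProbabilityMeasure.pi P) (ProbabilityMeasure.pi Q) ≤
      tradeoff (ProbabilityMeasure.pi P') (ProbabilityMeasure.pi Q') := by
  induction k with
  | zero =>
    -- With no factors the two laws coincide, and their tradeoff function `id` is the largest one.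
    have : ProbabilityMeasure.pi P' = ProbabilityMeasure.pi Q' := by
      congr
      exact funext fun i => i.elim0
    rw [this, tradeoff_self]
    exact tradeoff_le_self _ _
  | succ k ih =>
    have h1 := tradeoff_le_tradeoff_map (ProbabilityMeasure.pi P) (ProbabilityMeasure.pi Q)
      (MeasurableEquiv.piFinSuccAbove X 0).measurable
    have h2 := tradeoff_le_tradeoff_map
      ((P' 0).prod (ProbabilityMeasure.pi fun j => P' (Fin.succAbove 0 j)))
      ((Q' 0).prod (ProbabilityMeasure.pi fun j => Q' (Fin.succAbove 0 j)))
      (MeasurableEquiv.piFinSuccAbove X' 0).symm.measurable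
    rw [map_piFinSuccAbove, map_piFinSuccAbove] at h1
    rw [map_piFinSuccAbove_symm, map_piFinSuccAbove_symm] at h2
    exact h1.trans ((tradeoff_prod_mono (h 0) (ih fun j => h _)).trans h2)

end General

/-! ### Realization on the unit interval -/

/-- The uniform law on `[0,1]`. -/
def uniform : ProbabilityMeasure I := ⟨volume, inferInstance⟩

/-- The quantile function of the law on `[0,1]` whose distribution function is `f` on `[0,1)`. -/
def quantile (f : I → I) (u : I) : I := sInf {x | u ≤ f x}

theorem quantile_monotone (f : I → I) : Monotone (quantile f) := fun _ _ h =>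
  sInf_le_sInf fun _ hx => h.trans hx

theorem measurable_quantile (f : I → I) : Measurable (quantile f) :=
  (quantile_monotone f).measurable

/-- The infimum is attained by continuity unless the set is empty; then it is `1`, which `x < 1`
excludes. -/
theorem quantile_le_iff {f : I → I} (hf : Monotone f) (hc : Continuous f) (u : I) {x : I}
    (hx : x < 1) : quantile f u ≤ x ↔ u ≤ f x := by
  refine ⟨fun h => ?_, fun h => sInf_le h⟩
  have hne : {x | u ≤ f x}.Nonempty := by
    by_contra hne
    rw [not_nonempty_iff_eq_empty] at hne
    rw [quantile, hne, sInf_empty] at h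
    exact (h.trans_lt hx).not_ge le_top
  have hmem : quantile f u ∈ {x | u ≤ f x} :=
    (isClosed_le continuous_const hc).sInf_mem hne
  exact le_trans hmem (hf h)

theorem iterate_quantile_le_iff {f : I → I} (hf : Monotone f) (hc : Continuous f)
    (hf' : ∀ x, f x ≤ x) (j : ℕ) (u : I) {x : I} (hx : x < 1) :
    (quantile f)^[j] u ≤ x ↔ u ≤ f^[j] x := by
  induction j generalizing x with
  | zero => rfl
  | succ j ih =>
    rw [Function.iterate_succ_apply', quantile_le_iff hf hc _ hx, ih ((hf' x).trans_lt hx),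
      Function.iterate_succ_apply]

/-- The right derivative of `f`. -/
def density (f : I → I) (x : I) : ℝ := derivWithin (realExt f) (Ioi (x : ℝ)) x

theorem measurable_density (f : I → I) : Measurable (density f) :=
  (measurable_derivWithin_Ioi (realExt f)).comp measurable_subtype_coe

theorem density_nonneg {f : I → I} (hf : Monotone f) (x : I) : 0 ≤ density f x :=
  rightDeriv_realExt_nonneg hf x

/-! ### The law of the quantile map and its tradeoff against the uniform law -/

section Convex

variable {f : I → I} (hf : Monotone f) (hc : Continuous f)
  (hv : ConvexOn ℝ (Icc 0 1) (realExt f)) (hf' : ∀ x, f x ≤ x)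

include hf hc hv in
theorem integrableOn_rightDeriv (x : I) :
    IntegrableOn (fun y => derivWithin (realExt f) (Ioi y) y) (Ioc 0 (x : ℝ)) := by
  refine intervalIntegral.integrableOn_deriv_right_of_nonneg (g := realExt f)
    (continuous_subtype_val.comp (hc.comp continuous_projIcc)).continuousOn (fun y hy => ?_)
    fun y _ => rightDeriv_realExt_nonneg hf y
  refine hv.hasDerivWithinAt_rightDeriv_of_mem_interior ?_
  rw [interior_Icc]
  exact ⟨hy.1, hy.2.trans_le x.2.2⟩

include hf hc hv in
theorem integrable_rightDeriv : Integrable (density f) volume := by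
  have h := integrableOn_rightDeriv hf hc hv 1
  rw [← integrableOn_Icc_iff_integrableOn_Ioc] at h
  exact (unitInterval.measurePreserving_coe.integrable_comp_emb
    unitInterval.measurableEmbedding_coe).2 h

include hf hc hv hf' in
theorem setIntegral_density (x : I) : ∫ y in Iic x, density f y = f x := by
  have h1 := unitInterval.measurePreserving_coe.setIntegral_preimage_emb
    unitInterval.measurableEmbedding_coe (fun y => derivWithin (realExt f) (Ioi y) y) (Iic (x : ℝ))
  have h2 : Iic (x : ℝ) ∩ I = Icc 0 (x : ℝ) := by
    ext y
    simp only [mem_inter_iff, mem_Iic, mem_Icc]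
    exact ⟨fun h => ⟨h.2.1, h.1⟩, fun h => ⟨h.2, h.1, h.2.trans x.2.2⟩⟩
  rw [Measure.restrict_restrict measurableSet_Iic, h2, integral_Icc_eq_integral_Ioc,
    ← intervalIntegral.integral_of_le x.2.1,
    intervalIntegral.integral_eq_sub_of_hasDeriv_right_of_le (f := realExt f) x.2.1
      (continuous_subtype_val.comp (hc.comp continuous_projIcc)).continuousOn ?_
      ((intervalIntegrable_iff_integrableOn_Ioc_of_le x.2.1).2
        (integrableOn_rightDeriv hf hc hv x))] at h1
  · have h0 : realExt f 0 = 0 :=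
      le_antisymm (by rw [realExt, projIcc_left]; exact hf' 0) (f _).2.1
    rw [h0, sub_zero, realExt_coe] at h1
    exact h1
  · intro y hy
    refine hv.hasDerivWithinAt_rightDeriv_of_mem_interior ?_
    rw [interior_Icc]
    exact ⟨hy.1, hy.2.trans_le x.2.2⟩

include hf hc hv hf' in
-- Both sides have the same distribution function. The atom at `1` carries the mass of `u > f 1`,
-- where the quantile is an infimum over the empty set.
theorem map_quantile_eq :
    (volume : Measure I).map (quantile f) =
      (volume : Measure I).withDensity (fun x => ENNReal.ofReal (density f x)) +
        ENNReal.ofReal (1 - f 1) • Measure.dirac 1 := by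
  have hw (x : I) : (volume : Measure I).withDensity (fun x => ENNReal.ofReal (density f x))
      (Iic x) = ENNReal.ofReal (f x) := by
    rw [withDensity_apply _ measurableSet_Iic, ← ofReal_integral_eq_lintegral_ofReal
      (integrable_rightDeriv hf hc hv).integrableOn (.of_forall fun y => density_nonneg hf y),
      setIntegral_density hf hc hv hf']
  have : IsProbabilityMeasure ((volume : Measure I).map (quantile f)) :=
    Measure.isProbabilityMeasure_map (measurable_quantile f).aemeasurable
  refine Measure.ext_of_Iic _ _ fun x => ?_
  rw [Measure.add_apply, hw, Measure.smul_apply, smul_eq_mul,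
    Measure.dirac_apply' _ measurableSet_Iic]
  rcases (show x ≤ 1 from x.2.2).eq_or_lt with rfl | hx
  · have : Iic (1 : I) = univ := Iic_top
    rw [this, measure_univ]
    simp only [mem_univ, indicator_of_mem, Pi.one_apply, mul_one]
    rw [← ENNReal.ofReal_add (f 1).2.1 (sub_nonneg.2 (f 1).2.2)]
    simp
  · rw [Measure.map_apply (measurable_quantile f) measurableSet_Iic]
    have : quantile f ⁻¹' Iic x = Iic (f x) := by
      ext u
      exact quantile_le_iff hf hc u hx
    rw [this, unitInterval.volume_Iic]
    simp [hx]

include hf hc hv hf' in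
theorem power_map_quantile {φ : I → I} (hφ : Measurable φ) :
    power (uniform.map (measurable_quantile f).aemeasurable) φ =
      (∫ x, density f x * φ x) + (1 - f 1) * φ 1 := by
  have hd : Integrable (fun x => (φ x : ℝ))
      ((volume : Measure I).withDensity fun x => ENNReal.ofReal (density f x)) := by
    have : IsFiniteMeasure ((volume : Measure I).withDensity fun x => ENNReal.ofReal (density f x)) :=
      isFiniteMeasure_withDensity_ofReal (integrable_rightDeriv hf hc hv).2
    exact integrable_test _ hφ
  have hm : ((uniform.map (measurable_quantile f).aemeasurable : ProbabilityMeasure I) : Measure I) =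
      (volume : Measure I).map (quantile f) := rfl
  rw [power, hm, map_quantile_eq hf hc hv hf', integral_add_measure hd
    ((integrable_test _ hφ).smul_measure ENNReal.ofReal_ne_top), integral_smul_measure,
    integral_dirac, ENNReal.toReal_ofReal (sub_nonneg.2 (f 1).2.2), smul_eq_mul,
    integral_withDensity_eq_integral_toReal_smul (measurable_density f).ennreal_ofReal
      (.of_forall fun _ => ENNReal.ofReal_lt_top)]
  simp_rw [ENNReal.toReal_ofReal (density_nonneg hf _), smul_eq_mul]

include hf hc hv hf' in
/-- Neyman-Pearson for the uniform law against the law with increasing density. -/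
theorem le_tradeoff_quantile_of_mem_Ioo {α : I} (h0 : 0 < (α : ℝ)) (h1 : (α : ℝ) < 1) :
    f α ≤ tradeoff uniform (uniform.map (measurable_quantile f).aemeasurable) α := by
  refine le_tradeoff fun φ hφ h => ?_
  rw [power_map_quantile hf hc hv hf' hφ]
  have hi := integrable_rightDeriv hf hc hv
  have hφi := integrable_test (volume : Measure I) hφ
  have hφd : Integrable (fun x => density f x * φ x) (volume : Measure I) :=
    hi.mul_bdd (c := 1) (measurable_subtype_coe.comp hφ).aestronglyMeasurable
      (.of_forall fun x => by simpa [abs_of_nonneg (φ x).2.1] using (φ x).2.2)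
  -- The density increases on the open interval, so `density f x - density f α` changes sign at `α`
  -- and the best test is `1_{(α,1]}`.
  have hmain : ∫ x, (density f x * φ x - density f α * φ x) ≤
      ∫ x, (Ioi α).indicator (fun x => density f x - density f α) x := by
    refine integral_mono_ae (hφd.sub (hφi.const_mul _))
      ((hi.sub (integrable_const _)).indicator measurableSet_Ioi) ?_
    filter_upwards [compl_mem_ae_iff.2 (measure_singleton (0 : I)),
      compl_mem_ae_iff.2 (measure_singleton (1 : I))] with x hx0 hx1
    have hi (y : I) (hy0 : y ≠ 0) (hy1 : y ≠ 1) : (y : ℝ) ∈ interior (Icc (0 : ℝ) 1) := by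
      rw [interior_Icc]
      exact ⟨unitInterval.pos_iff_ne_zero.2 hy0, unitInterval.lt_one_iff_ne_one.2 hy1⟩
    have hα : (α : ℝ) ∈ interior (Icc (0 : ℝ) 1) := by
      rw [interior_Icc]
      exact ⟨h0, h1⟩
    have hx := hi x hx0 hx1
    rcases le_or_gt x α with h | h
    · rw [indicator_of_notMem (by simpa using h)]
      have : density f x ≤ density f α := hv.monotoneOn_rightDeriv hx hα h
      nlinarith [(φ x).2.1]
    · rw [indicator_of_mem (mem_Ioi.2 h)]
      have : density f α ≤ density f x := hv.monotoneOn_rightDeriv hα hx h.le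
      nlinarith [(φ x).2.2]
  have hr : ∫ x, (Ioi α).indicator (fun x => density f x - density f α) x =
      f 1 - f α - density f α * (1 - α) := by
    have h2 := integral_add_compl (measurableSet_Iic (a := α)) hi
    have h3 := setIntegral_density hf hc hv hf' 1
    have : Iic (1 : I) = univ := Iic_top
    rw [this, setIntegral_univ] at h3
    rw [setIntegral_density hf hc hv hf', h3, compl_Iic] at h2
    rw [integral_indicator measurableSet_Ioi, integral_sub hi.integrableOn
      (integrable_const _), setIntegral_const, smul_eq_mul, measureReal_def,
      unitInterval.volume_Ioi, ENNReal.toReal_ofReal (sub_nonneg.2 α.2.2)]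
    linarith
  rw [integral_sub hφd (hφi.const_mul _), integral_const_mul, hr] at hmain
  have h4 : ∫ x, (φ x : ℝ) ≤ 1 - α := h
  have h5 := mul_le_mul_of_nonneg_left h4 (density_nonneg hf α)
  have h6 : (1 - (f 1 : ℝ)) * φ 1 ≤ 1 - f 1 :=
    mul_le_of_le_one_right (sub_nonneg.2 (f 1).2.2) (φ 1).2.2
  linarith

include hf hc hv hf' in
theorem le_tradeoff_quantile :
    f ≤ tradeoff uniform (uniform.map (measurable_quantile f).aemeasurable) := by
  set T := tradeoff uniform (uniform.map (measurable_quantile f).aemeasurable) with hT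
  have hcl : IsClosed {x | f x ≤ T x} := isClosed_le hc (continuous_tradeoff _ _)
  have hd : Dense (Ioo (0 : I) 1) := by
    rw [dense_iff_closure_eq, closure_Ioo zero_ne_one]
    exact Icc_bot_top
  intro x
  refine hcl.closure_subset_iff.2 ?_ (hd x)
  intro α hα
  exact le_tradeoff_quantile_of_mem_Ioo hf hc hv hf' hα.1 hα.2

end Convex

/-- The chain of laws on `[0,1]` with distribution functions `f^[j]` on `[0,1)`. -/
def quantileChain (f : I → I) (j : ℕ) : ProbabilityMeasure I :=
  uniform.map (((measurable_quantile f).iterate j).aemeasurable)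

/-- The test `1_{(α,1]}` has power `1 - f^[j] α` under the `j`-th law when `α < 1`; the value at `1`
follows by approximation. -/
theorem tradeoff_quantileChain_le {f : I → I} (hf : Monotone f) (hc : Continuous f)
    (hf' : ∀ x, f x ≤ x) (a : ℕ) :
    tradeoff (quantileChain f 0) (quantileChain f a) ≤ f^[a] := by
  have key (α : I) (h1 : α < 1) :
      tradeoff (quantileChain f 0) (quantileChain f a) α ≤ f^[a] α := by
    let ψ : I → I := (Ioi α).indicator 1
    have hψ : Measurable ψ := measurable_one.indicator measurableSet_Ioi
    have hp (j : ℕ) : power (quantileChain f j) ψ = 1 - f^[j] α := by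
      have h2 : ∀ u, ((ψ ∘ (quantile f)^[j]) u : ℝ) = (Ioi (f^[j] α)).indicator 1 u := by
        intro u
        have h3 : (quantile f)^[j] u ∈ Ioi α ↔ u ∈ Ioi (f^[j] α) := by
          simpa using (iterate_quantile_le_iff hf hc hf' j u h1).not
        by_cases h : u ∈ Ioi (f^[j] α)
        · simp only [ψ, Function.comp, indicator_of_mem h, indicator_of_mem (h3.2 h)]
          rfl
        · simp only [ψ, Function.comp, indicator_of_notMem h, indicator_of_notMem (mt h3.1 h)]
          rfl
      rw [quantileChain, power_map _ ((measurable_quantile f).iterate j) hψ, power]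
      simp_rw [h2]
      rw [integral_indicator_one measurableSet_Ioi]
      show (volume : Measure I).real _ = _
      rw [measureReal_def, unitInterval.volume_Ioi,
        ENNReal.toReal_ofReal (sub_nonneg.2 (f^[j] α).2.2)]
    have h3 := tradeoff_le (quantileChain f 0) (quantileChain f a) (α := α) hψ (by simp [hp])
    rw [hp, sub_sub_cancel] at h3
    exact h3
  intro α
  rcases (show α ≤ 1 from α.2.2).eq_or_lt with rfl | h
  · exact tradeoff_one_le_of_forall_lt _ _ fun β _ hβ =>
      (key β hβ).trans (hf.iterate a β.2.2)
  · exact key α h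

/-- The two laws are images of the uniform law and of its quantile image under the same map
`(quantile f)^[j]`; data processing applies. -/
theorem le_tradeoff_quantileChain_succ {f : I → I} (hf : Monotone f) (hc : Continuous f)
    (hv : ConvexOn ℝ (Icc 0 1) (realExt f)) (hf' : ∀ x, f x ≤ x) (j : ℕ) :
    f ≤ tradeoff (quantileChain f j) (quantileChain f (j + 1)) := by
  refine (le_tradeoff_quantile hf hc hv hf').trans ((tradeoff_le_tradeoff_map _ _
    ((measurable_quantile f).iterate j)).trans_eq ?_)
  congr 1
  apply Subtype.ext
  exact Measure.map_map ((measurable_quantile f).iterate j) (measurable_quantile f)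

/-- Every iterate of a tradeoff function is realized along a chain with steps dominating `f`. -/
theorem exists_chain {f : I → I} (hf : IsTradeoffFunction.{u} f) :
    ∃ (X : Type u) (_ : MeasurableSpace X) (R : ℕ → ProbabilityMeasure X),
      (∀ j, f ≤ tradeoff (R j) (R (j + 1))) ∧ ∀ a, tradeoff (R 0) (R a) = f^[a] := by
  obtain ⟨Ω, _, P, Q, rfl⟩ := hf
  have hm := tradeoff_mono P Q
  have hc := continuous_tradeoff P Q
  have hv := convexOn_realExt_tradeoff P Q
  have hs := tradeoff_le_self P Q
  -- The lift moves the chain into the universe of `f`; data processing both ways leaves tradeoffs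
  -- unchanged.
  let R (j : ℕ) : ProbabilityMeasure (ULift.{u} I) :=
    (quantileChain (tradeoff P Q) j).map measurable_up.aemeasurable
  have hR (j : ℕ) : (R j).map measurable_down.aemeasurable = quantileChain (tradeoff P Q) j := by
    apply Subtype.ext
    exact (Measure.map_map measurable_down measurable_up).trans Measure.map_id
  have h1 (j : ℕ) : tradeoff P Q ≤ tradeoff (R j) (R (j + 1)) :=
    (le_tradeoff_quantileChain_succ hm hc hv hs j).trans
      (tradeoff_le_tradeoff_map _ _ measurable_up)
  refine ⟨ULift.{u} I, inferInstance, R, h1, fun a => le_antisymm ?_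
    (iterate_le_tradeoff_chain hm a fun j _ => h1 j)⟩
  have h2 := tradeoff_le_tradeoff_map (R 0) (R a) measurable_down
  rw [hR, hR] at h2
  exact h2.trans (tradeoff_quantileChain_le hm hc hs a)

/-- Independence of the chosen laws is monotonicity of products used in both directions. -/
theorem isTensorProduct_pi {k : ℕ} {f : Fin k → I → I} {X : Fin k → Type u}
    [∀ i, MeasurableSpace (X i)] (P Q : ∀ i, ProbabilityMeasure (X i))
    (h : ∀ i, f i = tradeoff (P i) (Q i)) :
    IsTensorProduct.{u} f (tradeoff (ProbabilityMeasure.pi P) (ProbabilityMeasure.pi Q)) :=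
  ⟨fun i => ⟨X i, inferInstance, P i, Q i, h i⟩, fun _ _ _ _ h' => le_antisymm
    (tradeoff_pi_mono fun i => ((h i).symm.trans (h' i)).le)
    (tradeoff_pi_mono fun i => ((h i).symm.trans (h' i)).ge)⟩

end SemiDP

end

/-! ### The proposition -/

theorem mainTheorem8 {𝒳 S : Type*} (𝒟 : Set (List 𝒳))
    (d : 𝒟 → 𝒟 → ℕ) (hd : SemiDP.IsAdjacencyMetric d)
    (T : 𝒟 → S) (t : S) (n : ℕ) (hn : ∀ X ∈ SemiDP.conforming T t, X.1.length = n)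
    (a : ℕ) (ha : SemiDP.semiAdjacentParameter d (SemiDP.conforming T t) n = (a : ℕ∞))
    (k : ℕ) (Y : Fin k → Type*) [∀ i, MeasurableSpace (Y i)]
    (M : ∀ i, 𝒟 → MeasureTheory.ProbabilityMeasure (Y i))
    (f : Fin k → unitInterval → unitInterval)
    (hf : ∀ i, SemiDP.IsTradeoffFunction.{u} (f i))
    (hM : ∀ i, (SemiDP.Guarantee.mk Set.univ (SemiDP.adj d 1) (f i)).SatisfiedBy (M i)) :
    ∃ F G : unitInterval → unitInterval,
      -- `F = f₁^{∘a} ⊗ ⋯ ⊗ f_k^{∘a}` and `G = f₁ ⊗ ⋯ ⊗ f_k`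
      SemiDP.IsTensorProduct.{u} (fun i => (f i)^[a]) F ∧
      SemiDP.IsTensorProduct.{u} f G ∧
      -- Semi-DP first
      ((∀ i, (SemiDP.Guarantee.mk (SemiDP.conforming T t) (SemiDP.adj d a)
          ((f i)^[a])).SatisfiedBy (M i)) ∧
        (SemiDP.Guarantee.mk (SemiDP.conforming T t) (SemiDP.adj d a) F).SatisfiedBy
          (SemiDP.joint M)) ∧
      -- composition first
      ((SemiDP.Guarantee.mk Set.univ (SemiDP.adj d 1) G).SatisfiedBy (SemiDP.joint M) ∧
        (SemiDP.Guarantee.mk (SemiDP.conforming T t) (SemiDP.adj d a) (G^[a])).SatisfiedBy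
          (SemiDP.joint M)) ∧
      -- comparison
      (SemiDP.Guarantee.mk (SemiDP.conforming T t) (SemiDP.adj d a) (G^[a])).Weaker
        (SemiDP.Guarantee.mk (SemiDP.conforming T t) (SemiDP.adj d a) F) := by
  choose X hX R hR1 hR2 using fun i => SemiDP.exists_chain (hf i)
  have hf1 (i) : f i = SemiDP.tradeoff (R i 0) (R i 1) := (hR2 i 1).symm
  have hmono (i) : Monotone (f i) := hf1 i ▸ SemiDP.tradeoff_mono _ _
  have hself (i) : ∀ x, f i x ≤ x := hf1 i ▸ SemiDP.tradeoff_le_self _ _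
  let R' (j : ℕ) := MeasureTheory.ProbabilityMeasure.pi fun i => R i j
  have hG : (SemiDP.Guarantee.mk Set.univ (SemiDP.adj d 1)
      (SemiDP.tradeoff (R' 0) (R' 1))).SatisfiedBy (SemiDP.joint M) :=
    fun x hx y hy hxy => SemiDP.tradeoff_pi_mono fun i => (hf1 i).symm.trans_le (hM i x hx y hy hxy)
  have hFi (i) := SemiDP.satisfiedBy_iterate hd (hmono i) (hself i) (hM i)
    (SemiDP.conforming T t) a
  refine ⟨SemiDP.tradeoff (R' 0) (R' a), SemiDP.tradeoff (R' 0) (R' 1),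
    SemiDP.isTensorProduct_pi _ _ fun i => (hR2 i a).symm, SemiDP.isTensorProduct_pi _ _ hf1,
    ⟨hFi, fun x hx y hy hxy => SemiDP.tradeoff_pi_mono fun i =>
      (hR2 i a).trans_le (hFi i x hx y hy hxy)⟩,
    ⟨hG, SemiDP.satisfiedBy_iterate hd (SemiDP.tradeoff_mono _ _) (SemiDP.tradeoff_le_self _ _)
      hG _ a⟩, subset_rfl, ?_⟩
  -- Group privacy along the product chain `R'`, each step of which dominates `T(R' 0, R' 1)`.
  exact SemiDP.iterate_le_tradeoff_chain (SemiDP.tradeoff_mono _ _) a fun j _ =>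
    SemiDP.tradeoff_pi_mono fun i => (hf1 i).symm.trans_le (hR1 i j)
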